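/- Let $a_1,\dots,a_k\in\mathbb{R}^m$ generate a lattice (discrete subgroup) $L=\sum_{j}\mathbb{Z}a_j$ of rank $r\le k$. Let $q_0\ge q\ge 1$ be integers and let $\hat a_1,\dots,\hat a_k\in\mathbb{Z}^m$ be approximations of the $a_j$ of precision $q$ with denominator $2^{q_0}$, i.e. $\left|\hat a_j^{(i)}/2^{q_0}-a_j^{(i)}\right|\le 2^{-q}$ for all $j\le k$ and all coordinates $i\le m$. Let $\tilde b_j=(m_j,\hat b_j)\in\mathbb{Z}^k\times\mathbb{Z}^m$, $1\le j\le k$, be an LLL-reduced basis (with the classical constant $3/4$), as output by the LLL algorithm, of the rank $k$ lattice generated by the vectors $\tilde a_j=(e_j,\hat a_j)$, where $e_j$ is the $j$-th unit vector of $\mathbb{Z}^k$. Let $0<\mu\le\lambda_1(L)=\min\{\|v\| : v\in L\setminus\{0\}\}$ (no upper bound on $\mu$ if $L=0$), let $\alpha\ge\max_j\|a_j\|$, and let $\det(L)$ be the square root of the Gram determinant of a $\mathbb{Z}$-basis of $L$ (so $\det(0)=1$). Put $$\lambda:=\left(k\sqrt m\,2^{q_0-q}+\sqrt k\right)\frac{\alpha^r}{\det(L)}$$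 and assume $$2^q>\frac{(\sqrt{mk}+1)\,\lambda\,2^{\frac{k-1}{2}}}{\mu}.$$ Choose any $r$ linearly independent vectors among the $a_j$, let $L_r$ be the lattice they generate, and for $1\le j\le r$ let $\lambda_j(L_r)$ be its $j$-th successive minimum, the least $\rho$ such that $L_r$ contains $j$ linearly independent vectors of norm at most $\rho$. Then: 1. the vectors $m_1,\dots,m_{k-r}$ are linearly independent relations for the $a_j$, i.e. $\sum_{l\le k}m_j^{(l)}a_l=0$ for $j\le k-r$; 2. the vectors $b_j=\sum_{l\le k}m_{k-r+j}^{(l)}a_l$, $1\le j\le r$, form a basis of $L$, and $$\|b_j\|\le(\sqrt{km}+1)\,2^{\frac{k-1}{2}+1+q_0-q}\,\lambda_j(L_r);$$ 3. in the Euclidean norm, $$\|m_j\|\le 2^{\frac{k-1}{2}}\lambda\quad(1\le j\le k-r),\qquad \|m_j\|\le 2^{\frac{k-1}{2}+q_0+1}\lambda_{j-k+r}(L_r)\quad(k-r+1\le j\le k).$$ -/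

import Mathlib

noncomputable section

namespace ApproxLattice

/-- The integer vector `z`, seen as a point of Euclidean space. -/
def intVec {ι : Type*} (z : ι → ℤ) : EuclideanSpace ℝ ι :=
  WithLp.toLp 2 (fun i => (z i : ℝ))

/-- The integer vector `ahat` is an approximation of `a` with precision `q` and
denominator `2 ^ q₀`. -/
def IsApprox {m : ℕ} (q₀ q : ℕ) (ahat : Fin m → ℤ) (a : EuclideanSpace ℝ (Fin m)) : Prop :=
  ∀ i, |(ahat i : ℝ) / 2 ^ q₀ - a i| ≤ 1 / 2 ^ q

/-- The subgroup `∑ j, ℤ a_j` generated by a finite family of vectors. -/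
def latticeOf {ι E : Type*} [AddCommGroup E] (a : ι → E) : Submodule ℤ E :=
  Submodule.span ℤ (Set.range a)

/-- The augmented vectors `(e_j, ahat_j)` in `ℤ^k × ℤ^m`. -/
def augmented {k m : ℕ} (ahat : Fin k → Fin m → ℤ) (j : Fin k) : Fin k ⊕ Fin m → ℤ :=
  Sum.elim (Pi.single j 1) (ahat j)

section Lattice

variable {E : Type*} [NormedAddCommGroup E] [InnerProductSpace ℝ E]

open Classical in
/-- The determinant of a lattice `L`, not necessarily of full rank: the square root of the Gram
determinant of a `ℤ`-basis of `L` (which does not depend on the basis). For `L = 0` it is `1`. -/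
def latticeDet (L : Submodule ℤ E) : ℝ :=
  if h : Nonempty (Module.Basis (Fin (Module.finrank ℤ L)) ℤ L) then
    √(Matrix.gram ℝ fun i => (h.some i : E)).det
  else 0

/-- The `j`-th successive minimum of `L` (for `1 ≤ j ≤ rank L`): the least radius such that the
closed ball of that radius contains `j` linearly independent vectors of `L`. -/
def successiveMin (L : Submodule ℤ E) (j : ℕ) : ℝ :=
  sInf {ρ : ℝ | 0 ≤ ρ ∧ ∃ v : Fin j → E, LinearIndependent ℝ v ∧ ∀ i, v i ∈ L ∧ ‖v i‖ ≤ ρ}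

/-- The Gram–Schmidt coefficient `μ_{i,j} = ⟨v_i, v_j*⟩ / ⟨v_j*, v_j*⟩`. -/
def gsCoeff {k : ℕ} (v : Fin k → E) (i j : Fin k) : ℝ :=
  inner ℝ (v i) (InnerProductSpace.gramSchmidt ℝ v j) /
    ‖InnerProductSpace.gramSchmidt ℝ v j‖ ^ 2

/-- A linearly independent family is LLL-reduced (with the classical constant `3/4`) if it is
size-reduced and consecutive vectors satisfy the Lovász condition. -/
structure IsLLLReduced {k : ℕ} (v : Fin k → E) : Prop where
  linearIndependent : LinearIndependent ℝ v
  size_reduced : ∀ i j : Fin k, j < i → |gsCoeff v i j| ≤ 1 / 2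
  lovasz : ∀ i j : Fin k, (j : ℕ) + 1 = i →
    3 / 4 * ‖InnerProductSpace.gramSchmidt ℝ v j‖ ^ 2 ≤
      ‖InnerProductSpace.gramSchmidt ℝ v i +
        gsCoeff v i j • InnerProductSpace.gramSchmidt ℝ v j‖ ^ 2

/-- `b` is an LLL-reduced basis of the lattice `L`. -/
def IsLLLReducedBasis {k : ℕ} (L : Submodule ℤ E) (b : Fin k → E) : Prop :=
  IsLLLReduced b ∧ latticeOf b = L

end Lattice

/-- The first `k - r` indices among `k`. -/
def firstIdx {k r : ℕ} (j : Fin (k - r)) : Fin k := ⟨j, by omega⟩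

/-- The last `r` indices among `k`: `j ↦ k - r + j`. -/
def lastIdx {k r : ℕ} (hrk : r ≤ k) (j : Fin r) : Fin k := ⟨k - r + j, by omega⟩

/-- The coefficient part `m_j ∈ ℤ^k` of the vector `(m_j, bhat_j)`. -/
def coeffPart {k m : ℕ} (b : Fin k → Fin k ⊕ Fin m → ℤ) (j : Fin k) : Fin k → ℤ :=
  fun l => b j (Sum.inl l)

/-- The integral combination `∑ l, c_l a_l`. -/
def intComb {k : ℕ} {E : Type*} [AddCommGroup E] (c : Fin k → ℤ) (a : Fin k → E) : E :=
  ∑ l, c l • a l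

end ApproxLattice

end

open ApproxLattice

/-!
The augmented lattice is the graph of `x ↦ ∑ l, x_l ahat_l` over `ℤ ^ k`, so an augmented vector
`(x, ∑ l, x_l ahat_l)` is short when `x` is short and `∑ l, x_l a_l` vanishes. Cramer's rule in
coordinates with respect to a basis of `L`, one rule for each generator outside the chosen `r`,
gives `k - r` independent relations. Up to sign, their entries are quotients by `det L` of square
roots of Gram determinants of `r` generators, hence at most `α ^ r / det L` by Hadamard's
inequality. The `j`-th vector of an LLL-reduced basis is, up to the factor `2 ^ ((k - 1) / 2)`, no
longer than the longest of any `j` independent lattice vectors; applied to these relations, this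
bounds the first `k - r` basis vectors by a multiple of `λ`. The precision assumption then forces
`‖∑ l, x_l a_l‖ < μ` for their coefficient parts `x`, so these are relations and the remaining `r`
basis vectors map onto generators of `L`. Adjoining to the `k - r` relations the lifts of `j`
independent vectors of `L_r` bounds the `(k - r + j)`-th basis vector by the `j`-th successive
minimum of `L_r`.
-/

namespace ApproxLattice

open InnerProductSpace Matrix Module

section GramDeterminant

theorem gram_sum_smul {𝕜 E ι κ : Type*} [RCLike 𝕜] [NormedAddCommGroup E]
    [InnerProductSpace 𝕜 E] [Fintype κ] (v : κ → E) (P : Matrix ι κ 𝕜) :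
    gram 𝕜 (fun i => ∑ j, P i j • v j) = P.map star * gram 𝕜 v * Pᵀ := by
  ext i j
  simp only [gram_apply, sum_inner, inner_sum, inner_smul_left, inner_smul_right, mul_apply,
    map_apply, transpose_apply, Finset.mul_sum, Finset.sum_mul, starRingEnd_apply]
  exact Finset.sum_congr rfl fun x _ => Finset.sum_congr rfl fun y _ => by ring

variable {E ι : Type*} [NormedAddCommGroup E] [InnerProductSpace ℝ E] [Fintype ι] [DecidableEq ι]

theorem sqrt_det_gram_le_prod_norm (v : ι → E) : √(gram ℝ v).det ≤ ∏ i, ‖v i‖ := by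
  by_cases hdet : (gram ℝ v).det = 0
  · simpa only [hdet, Real.sqrt_zero] using Finset.prod_nonneg fun i _ => norm_nonneg (v i)
  have hv : LinearIndependent ℝ v := linearIndependent_of_det_gram_ne_zero hdet
  let S := Submodule.span ℝ (Set.range v)
  have : FiniteDimensional ℝ S := FiniteDimensional.span_of_finite ℝ (Set.finite_range v)
  have : Fact (finrank ℝ S = Fintype.card ι) := ⟨finrank_span_eq_card hv⟩
  let e := Fintype.equivFin ι
  let b : OrthonormalBasis (Fin (Fintype.card ι)) ℝ S :=
    (stdOrthonormalBasis ℝ S).reindex (finCongr Fact.out)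
  let w : Fin (Fintype.card ι) → S :=
    fun i => ⟨v (e.symm i), Submodule.subset_span (Set.mem_range_self _)⟩
  have hgram : (gram ℝ v).det = b.toBasis.det w ^ 2 := by
    have hw : gram ℝ w = (gram ℝ v).submatrix e.symm e.symm := rfl
    rw [← det_submatrix_equiv_self e.symm, ← hw, gram_eq_conjTranspose_mul b, det_mul,
      det_conjTranspose, star_trivial, ← sq, Basis.det_apply]
    rfl
  calc √(gram ℝ v).det = |b.toBasis.orientation.volumeForm w| := by
        rw [hgram, Real.sqrt_sq_eq_abs, Orientation.volumeForm_robust']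
    _ ≤ ∏ i, ‖w i‖ := Orientation.abs_volumeForm_apply_le _ w
    _ = ∏ i, ‖v i‖ := e.symm.prod_comp fun i => ‖v i‖

theorem det_gram_eq_sq_det_mul {L : Submodule ℤ E} (B : Basis ι ℤ L) (w : ι → L) :
    (gram ℝ fun i => (w i : E)).det =
      (B.det w : ℝ) ^ 2 * (gram ℝ fun i => (B i : E)).det := by
  set P : Matrix ι ι ℝ := ((B.toMatrix w).map (Int.castRingHom ℝ))ᵀ with hP
  have hw : (fun i => (w i : E)) = fun i => ∑ j, P i j • (B j : E) := by
    funext i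
    have hrepr := congrArg L.subtype (B.sum_repr (w i)).symm
    rw [map_sum] at hrepr
    simpa only [hP, transpose_apply, map_apply, Basis.toMatrix_apply, eq_intCast, map_smul,
      Submodule.subtype_apply, Int.cast_smul_eq_zsmul] using hrepr
  have hdet : P.det = B.det w := by
    rw [hP, det_transpose, ← RingHom.mapMatrix_apply, ← RingHom.map_det, Basis.det_apply]
    rfl
  have hstar : P.map star = P := Matrix.ext fun _ _ => star_trivial _
  rw [hw, gram_sum_smul, hstar, det_mul, det_mul, det_transpose P, hdet]
  ring

end GramDeterminant

section LatticeDet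

variable {E : Type*} [NormedAddCommGroup E] [InnerProductSpace ℝ E] {L : Submodule ℤ E} {r : ℕ}

theorem latticeDet_eq_sqrt_det_gram (B : Basis (Fin r) ℤ L) :
    latticeDet L = √(gram ℝ fun i => (B i : E)).det := by
  obtain rfl : finrank ℤ L = r := by simpa using finrank_eq_card_basis B
  have hL : Nonempty (Basis (Fin (finrank ℤ L)) ℤ L) := ⟨B⟩
  have hdet : (B.det hL.some : ℝ) ^ 2 = 1 := by
    exact_mod_cast Int.isUnit_sq (B.isUnit_det hL.some)
  rw [latticeDet, dif_pos hL, det_gram_eq_sq_det_mul B hL.some, hdet, one_mul]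

theorem abs_det_mul_latticeDet (B : Basis (Fin r) ℤ L) (w : Fin r → L) :
    |(B.det w : ℝ)| * latticeDet L = √(gram ℝ fun i => (w i : E)).det := by
  rw [latticeDet_eq_sqrt_det_gram B, det_gram_eq_sq_det_mul B w, Real.sqrt_mul (sq_nonneg _),
    Real.sqrt_sq_eq_abs]

theorem abs_det_mul_latticeDet_le (B : Basis (Fin r) ℤ L) (w : Fin r → L) :
    |(B.det w : ℝ)| * latticeDet L ≤ ∏ i, ‖w i‖ :=
  (abs_det_mul_latticeDet B w).trans_le (sqrt_det_gram_le_prod_norm fun i => (w i : E))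

theorem abs_det_mul_latticeDet_pos (B : Basis (Fin r) ℤ L) {w : Fin r → L}
    (hw : LinearIndependent ℝ fun i => (w i : E)) : 0 < |(B.det w : ℝ)| * latticeDet L := by
  rw [abs_det_mul_latticeDet]
  exact Real.sqrt_pos.2 (posDef_gram_of_linearIndependent hw).det_pos

theorem det_ne_zero_of_linearIndependent (B : Basis (Fin r) ℤ L) {w : Fin r → L}
    (hw : LinearIndependent ℝ fun i => (w i : E)) : B.det w ≠ 0 := by
  intro h
  simpa [h] using abs_det_mul_latticeDet_pos B hw

theorem latticeDet_pos (B : Basis (Fin r) ℤ L) {w : Fin r → L}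
    (hw : LinearIndependent ℝ fun i => (w i : E)) : 0 < latticeDet L :=
  pos_of_mul_pos_right (abs_det_mul_latticeDet_pos B hw) (abs_nonneg _)

end LatticeDet

section Cramer

theorem det_smul_eq_sum_det_update_smul {R M ι : Type*} [CommRing R] [AddCommGroup M] [Module R M]
    [Fintype ι] [DecidableEq ι] (B : Basis ι R M) (w : ι → M) (v : M) :
    B.det w • v = ∑ i, B.det (Function.update w i v) • w i := by
  refine B.ext_elem fun j => ?_
  have hcramer := congrFun (mulVec_cramer (B.toMatrix w) (B.repr v)) j
  simp only [mulVec, dotProduct, cramer_apply, ← Basis.toMatrix_update, ← Basis.det_apply,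
    Pi.smul_apply] at hcramer
  simp only [Basis.toMatrix_apply, smul_eq_mul] at hcramer
  simpa [mul_comm] using hcramer.symm

theorem det_update_sum_smul {R M N ι : Type*} [CommRing R] [AddCommGroup M] [Module R M]
    [AddCommGroup N] [Module R N] [Fintype ι] [DecidableEq ι] (f : M [⋀^ι]→ₗ[R] N) (w : ι → M)
    (c : ι → R) (i : ι) : f (Function.update w i (∑ j, c j • w j)) = c i • f w := by
  rw [f.map_update_sum, Finset.sum_eq_single_of_mem i (Finset.mem_univ i), f.map_update_smul,
    Function.update_eq_self]
  intro j _ hji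
  rw [f.map_update_smul, f.map_update_self _ hji.symm, smul_zero]

end Cramer

section GramSchmidt

variable {𝕜 E ι : Type*} [RCLike 𝕜] [NormedAddCommGroup E] [InnerProductSpace 𝕜 E]

theorem norm_sum_sq_of_pairwise_inner_eq_zero (s : Finset ι) (g : ι → E)
    (hg : Pairwise fun i j => inner 𝕜 (g i) (g j) = 0) :
    ‖∑ i ∈ s, g i‖ ^ 2 = ∑ i ∈ s, ‖g i‖ ^ 2 := by
  classical
  induction s using Finset.induction_on with
  | empty => simp
  | insert i s hi ih =>
    have horth : inner 𝕜 (g i) (∑ j ∈ s, g j) = 0 := by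
      rw [inner_sum]
      exact Finset.sum_eq_zero fun j hj => hg (ne_of_mem_of_not_mem hj hi).symm
    rw [Finset.sum_insert hi, Finset.sum_insert hi, ← ih, sq, sq, sq]
    exact norm_add_sq_eq_norm_sq_add_norm_sq_of_inner_eq_zero _ _ horth

variable [LinearOrder ι] [LocallyFiniteOrderBot ι] [WellFoundedLT ι] (v : ι → E)

theorem inner_gramSchmidt_self (i : ι) :
    inner 𝕜 (gramSchmidt 𝕜 v i) (v i) = (‖gramSchmidt 𝕜 v i‖ : 𝕜) ^ 2 := by
  conv_lhs => rw [gramSchmidt_def'' 𝕜 v i]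
  rw [inner_add_right, inner_sum, Finset.sum_eq_zero, add_zero, inner_self_eq_norm_sq_to_K]
  intro l hl
  rw [inner_smul_right, gramSchmidt_orthogonal 𝕜 v (Finset.mem_Iio.1 hl).ne', mul_zero]

theorem inner_gramSchmidt_sum_smul [Fintype ι] {c : ι → 𝕜} {i : ι}
    (hc : ∀ l, i < l → c l = 0) :
    inner 𝕜 (gramSchmidt 𝕜 v i) (∑ l, c l • v l) = c i * (‖gramSchmidt 𝕜 v i‖ : 𝕜) ^ 2 := by
  rw [inner_sum, Finset.sum_eq_single_of_mem i (Finset.mem_univ i), inner_smul_right,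
    inner_gramSchmidt_self]
  intro l _ hl
  rw [inner_smul_right]
  rcases hl.lt_or_gt with hli | hil
  · rw [gramSchmidt_inv_triangular 𝕜 v hli, mul_zero]
  · rw [hc l hil, zero_mul]

theorem norm_gramSchmidt_le_norm_sum_smul [Fintype ι] {c : ι → 𝕜} {i : ι}
    (hc : ∀ l, i < l → c l = 0) (hci : 1 ≤ ‖c i‖) :
    ‖gramSchmidt 𝕜 v i‖ ≤ ‖∑ l, c l • v l‖ := by
  rcases (norm_nonneg (gramSchmidt 𝕜 v i)).eq_or_lt with hzero | hpos
  · exact hzero ▸ norm_nonneg _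
  · refine le_of_mul_le_mul_left ?_ hpos
    calc ‖gramSchmidt 𝕜 v i‖ * ‖gramSchmidt 𝕜 v i‖
        ≤ ‖c i‖ * ‖gramSchmidt 𝕜 v i‖ ^ 2 := by
          rw [← sq]
          exact le_mul_of_one_le_left (sq_nonneg _) hci
      _ = ‖inner 𝕜 (gramSchmidt 𝕜 v i) (∑ l, c l • v l)‖ := by
          rw [inner_gramSchmidt_sum_smul v hc]
          simp
      _ ≤ _ := norm_inner_le_norm _ _

end GramSchmidt

section Reduced

variable {E : Type*} [NormedAddCommGroup E] [InnerProductSpace ℝ E] {k : ℕ} {v : Fin k → E}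

theorem norm_sq_eq_add_sum_gsCoeff_sq (v : Fin k → E) (i : Fin k) :
    ‖v i‖ ^ 2 = ‖gramSchmidt ℝ v i‖ ^ 2 +
      ∑ l ∈ Finset.Iio i, gsCoeff v i l ^ 2 * ‖gramSchmidt ℝ v l‖ ^ 2 := by
  have hdecomp : v i = gramSchmidt ℝ v i +
      ∑ l ∈ Finset.Iio i, gsCoeff v i l • gramSchmidt ℝ v l := by
    simpa [gsCoeff, real_inner_comm] using gramSchmidt_def'' ℝ v i
  have horth : inner ℝ (gramSchmidt ℝ v i)
      (∑ l ∈ Finset.Iio i, gsCoeff v i l • gramSchmidt ℝ v l) = 0 := by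
    rw [inner_sum]
    refine Finset.sum_eq_zero fun l hl => ?_
    rw [inner_smul_right, gramSchmidt_orthogonal ℝ v (Finset.mem_Iio.1 hl).ne', mul_zero]
  conv_lhs => rw [hdecomp]
  rw [norm_add_sq_real, horth, norm_sum_sq_of_pairwise_inner_eq_zero (𝕜 := ℝ)]
  · simp [norm_smul, mul_pow]
  · intro x y hxy
    simp only [inner_smul_left, inner_smul_right, gramSchmidt_orthogonal ℝ v hxy, mul_zero]

theorem IsLLLReduced.gsCoeff_sq_le (h : IsLLLReduced v) {i j : Fin k} (hji : j < i) :
    gsCoeff v i j ^ 2 ≤ 1 / 4 :=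
  (sq_le_sq.2 ((h.size_reduced i j hji).trans (le_abs_self _))).trans_eq (by norm_num)

theorem IsLLLReduced.norm_gramSchmidt_sq_le_succ (h : IsLLLReduced v) {i j : Fin k}
    (hij : (j : ℕ) + 1 = i) :
    ‖gramSchmidt ℝ v j‖ ^ 2 ≤ 2 * ‖gramSchmidt ℝ v i‖ ^ 2 := by
  have hji : j < i := Fin.lt_def.2 (by omega)
  have hlovasz := h.lovasz i j hij
  rw [norm_add_sq_real, inner_smul_right, gramSchmidt_orthogonal ℝ v hji.ne', norm_smul, mul_pow,
    Real.norm_eq_abs, sq_abs] at hlovasz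
  nlinarith [h.gsCoeff_sq_le hji, sq_nonneg ‖gramSchmidt ℝ v j‖]

theorem IsLLLReduced.two_pow_mul_norm_gramSchmidt_sq_le (h : IsLLLReduced v) {i j : Fin k}
    (hji : j ≤ i) :
    2 ^ (j : ℕ) * ‖gramSchmidt ℝ v j‖ ^ 2 ≤ 2 ^ (i : ℕ) * ‖gramSchmidt ℝ v i‖ ^ 2 := by
  obtain ⟨i, hi⟩ := i
  induction i with
  | zero =>
    obtain rfl : j = ⟨0, hi⟩ := le_antisymm hji (Fin.le_def.2 (Nat.zero_le _))
    rfl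
  | succ n ih =>
    rcases hji.eq_or_lt with rfl | hlt
    · rfl
    have hn : n < k := n.lt_succ_self.trans hi
    calc 2 ^ (j : ℕ) * ‖gramSchmidt ℝ v j‖ ^ 2
        ≤ 2 ^ n * ‖gramSchmidt ℝ v ⟨n, hn⟩‖ ^ 2 := ih hn (Nat.lt_succ_iff.1 (Fin.lt_def.1 hlt))
      _ ≤ 2 ^ n * (2 * ‖gramSchmidt ℝ v ⟨n + 1, hi⟩‖ ^ 2) := by
          gcongr
          exact h.norm_gramSchmidt_sq_le_succ rfl
      _ = 2 ^ (n + 1) * ‖gramSchmidt ℝ v ⟨n + 1, hi⟩‖ ^ 2 := by ring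

theorem sum_Iio_val {M : Type*} [AddCommMonoid M] (f : ℕ → M) (j : Fin k) :
    ∑ l ∈ Finset.Iio j, f l = ∑ l ∈ Finset.range j, f l := by
  rw [← Nat.Iio_eq_range, ← Fin.map_valEmbedding_Iio, Finset.sum_map]
  rfl

theorem IsLLLReduced.norm_sq_le (h : IsLLLReduced v) (j : Fin k) :
    ‖v j‖ ^ 2 ≤ 2 ^ (j : ℕ) * ‖gramSchmidt ℝ v j‖ ^ 2 := by
  set G := 2 ^ (j : ℕ) * ‖gramSchmidt ℝ v j‖ ^ 2 with hG
  have hterm : ∀ l ∈ Finset.Iio j, gsCoeff v j l ^ 2 * ‖gramSchmidt ℝ v l‖ ^ 2 ≤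
      1 / 4 * (G * (1 / 2) ^ (l : ℕ)) := by
    intro l hl
    have hlj := Finset.mem_Iio.1 hl
    have hG_l : ‖gramSchmidt ℝ v l‖ ^ 2 ≤ G * (1 / 2) ^ (l : ℕ) := by
      rw [one_div, inv_pow, ← div_eq_mul_inv, le_div_iff₀' (by positivity)]
      exact h.two_pow_mul_norm_gramSchmidt_sq_le hlj.le
    gcongr
    exact h.gsCoeff_sq_le hlj
  have hgeom : ∑ l ∈ Finset.Iio j, (1 / 2 : ℝ) ^ (l : ℕ) = 2 - 2 * (1 / 2) ^ (j : ℕ) := by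
    rw [sum_Iio_val (fun l => (1 / 2 : ℝ) ^ l), geom_sum_eq (by norm_num)]
    ring
  have hG_j : ‖gramSchmidt ℝ v j‖ ^ 2 = G * (1 / 2) ^ (j : ℕ) := by
    rw [hG, mul_right_comm, ← mul_pow]
    norm_num
  calc ‖v j‖ ^ 2
      ≤ G * (1 / 2) ^ (j : ℕ) + ∑ l ∈ Finset.Iio j, 1 / 4 * (G * (1 / 2) ^ (l : ℕ)) := by
        rw [norm_sq_eq_add_sum_gsCoeff_sq, hG_j]
        exact add_le_add_right (Finset.sum_le_sum hterm) _
    _ = G * ((1 + (1 / 2) ^ (j : ℕ)) / 2) := by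
        rw [← Finset.mul_sum, ← Finset.mul_sum, hgeom]
        ring
    _ ≤ G := by
        have hpow : (1 / 2 : ℝ) ^ (j : ℕ) ≤ 1 := pow_le_one₀ (by norm_num) (by norm_num)
        exact mul_le_of_le_one_right (by positivity) (by linarith)

theorem exists_norm_gramSchmidt_le {x : E} {j : Fin k} (hx : x ∈ latticeOf v)
    (hxj : x ∉ Submodule.span ℝ (v '' Set.Iio j)) :
    ∃ i, j ≤ i ∧ ‖gramSchmidt ℝ v i‖ ≤ ‖x‖ := by
  obtain ⟨c, rfl⟩ := (Submodule.mem_span_range_iff_exists_fun ℤ).1 hx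
  simp only [← Int.cast_smul_eq_zsmul ℝ] at hxj ⊢
  have hne : {l | j ≤ l ∧ c l ≠ 0}.Nonempty := by
    by_contra! hempty
    refine hxj (Submodule.sum_mem _ fun l _ => ?_)
    rcases lt_or_ge l j with hl | hl
    · exact Submodule.smul_mem _ _ (Submodule.subset_span ⟨l, hl, rfl⟩)
    · have hcl : c l = 0 := not_not.1 fun hcl => hempty.subset ⟨hl, hcl⟩
      simp [hcl]
  obtain ⟨i, ⟨hji, hci⟩, hmax⟩ := (Set.toFinite _).exists_maximal hne
  refine ⟨i, hji, norm_gramSchmidt_le_norm_sum_smul v (fun l hil => ?_) ?_⟩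
  · by_contra hcl
    exact hil.not_ge (hmax ⟨hji.trans hil.le, mod_cast hcl⟩ hil.le)
  · simpa using mod_cast Int.one_le_abs hci

theorem exists_notMem_of_finrank_lt_card {K V ι : Type*} [DivisionRing K] [AddCommGroup V]
    [Module K V] [Fintype ι] {x : ι → V} (hx : LinearIndependent K x) (W : Submodule K V)
    [FiniteDimensional K W] (hW : finrank K W < Fintype.card ι) : ∃ t, x t ∉ W := by
  by_contra! hmem
  have hle : Submodule.span K (Set.range x) ≤ W :=
    Submodule.span_le.2 (Set.range_subset_iff.2 hmem)
  exact hW.not_ge (finrank_span_eq_card hx ▸ Submodule.finrank_mono hle)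

theorem finrank_span_image_Iio_le (v : Fin k → E) (j : Fin k) :
    finrank ℝ (Submodule.span ℝ (v '' Set.Iio j)) ≤ j := by
  rw [Set.image_eq_range]
  simpa [Set.finrank] using finrank_range_le_card (R := ℝ) fun l : Set.Iio j => v l

theorem two_pow_le_sq_two_rpow (i : Fin k) :
    (2 : ℝ) ^ (i : ℕ) ≤ ((2 : ℝ) ^ (((k : ℝ) - 1) / 2)) ^ 2 := by
  have hik : ((i : ℕ) : ℝ) + 1 ≤ k := mod_cast i.isLt
  rw [← Real.rpow_natCast, ← Real.rpow_mul_natCast zero_le_two]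
  refine Real.rpow_le_rpow_of_exponent_le one_le_two ?_
  push_cast
  linarith

theorem IsLLLReduced.norm_le_of_linearIndependent (h : IsLLLReduced v) {ι : Type*} [Fintype ι]
    {x : ι → E} (hx : LinearIndependent ℝ x) (hmem : ∀ t, x t ∈ latticeOf v) {M : ℝ}
    (hM : ∀ t, ‖x t‖ ≤ M) {j : Fin k} (hj : (j : ℕ) < Fintype.card ι) :
    ‖v j‖ ≤ (2 : ℝ) ^ (((k : ℝ) - 1) / 2) * M := by
  have : FiniteDimensional ℝ (Submodule.span ℝ (v '' Set.Iio j)) :=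
    FiniteDimensional.span_of_finite ℝ (Set.toFinite _)
  obtain ⟨t, ht⟩ := exists_notMem_of_finrank_lt_card hx (Submodule.span ℝ (v '' Set.Iio j))
    ((finrank_span_image_Iio_le v j).trans_lt hj)
  obtain ⟨i, hji, hi⟩ := exists_norm_gramSchmidt_le (hmem t) ht
  have hgs : ‖gramSchmidt ℝ v i‖ ≤ M := hi.trans (hM t)
  have hM_nonneg : 0 ≤ M := (norm_nonneg _).trans hgs
  refine le_of_sq_le_sq ?_ (by positivity)
  calc ‖v j‖ ^ 2 ≤ 2 ^ (j : ℕ) * ‖gramSchmidt ℝ v j‖ ^ 2 := h.norm_sq_le j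
    _ ≤ 2 ^ (i : ℕ) * ‖gramSchmidt ℝ v i‖ ^ 2 := h.two_pow_mul_norm_gramSchmidt_sq_le hji
    _ ≤ ((2 : ℝ) ^ (((k : ℝ) - 1) / 2)) ^ 2 * M ^ 2 := by
        gcongr
        exact two_pow_le_sq_two_rpow i
    _ = _ := (mul_pow _ _ 2).symm

end Reduced

section Generators

variable {E : Type*} [AddCommGroup E] {k r : ℕ}

theorem intComb_sub (c d : Fin k → ℤ) (a : Fin k → E) :
    intComb (c - d) a = intComb c a - intComb d a := by
  simp only [intComb, Pi.sub_apply, sub_smul, Finset.sum_sub_distrib]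

theorem intComb_single (l : Fin k) (n : ℤ) (a : Fin k → E) :
    intComb (Pi.single l n) a = n • a l := by
  simp [intComb, Pi.single_apply, ite_smul]

theorem intComb_extend {s : Fin r → Fin k} (hs : Function.Injective s) (c : Fin r → ℤ)
    (a : Fin k → E) : intComb (Function.extend s c 0) a = ∑ i, c i • a (s i) := by
  refine (Fintype.sum_of_injective s hs _ _ (fun t ht => ?_) fun i => ?_).symm
  · rw [Function.extend_apply' _ _ _ ht, Pi.zero_apply, zero_smul]
  · rw [hs.extend_apply]

theorem intComb_mem_latticeOf (c : Fin k → ℤ) (a : Fin k → E) : intComb c a ∈ latticeOf a :=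
  (Submodule.mem_span_range_iff_exists_fun ℤ).2 ⟨c, rfl⟩

theorem map_latticeOf {ι F : Type*} [AddCommGroup F] (f : E →ₗ[ℤ] F) (a : ι → E) :
    (latticeOf a).map f = latticeOf (f ∘ a) := by
  rw [latticeOf, Submodule.map_span, ← Set.range_comp, latticeOf]

theorem latticeOf_comp_le {ι κ : Type*} (a : ι → E) (s : κ → ι) :
    latticeOf (a ∘ s) ≤ latticeOf a :=
  Submodule.span_mono (Set.range_comp_subset_range s a)

/-- The `l`-th generator, as an element of the lattice generated by `a`. -/
def generator {ι : Type*} (a : ι → E) (l : ι) : latticeOf a :=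
  ⟨a l, Submodule.subset_span (Set.mem_range_self l)⟩

theorem exists_basis_latticeOf [IsAddTorsionFree E] {ι : Type*} [Finite ι]
    (a : ι → E) {r : ℕ} (hr : finrank ℤ (latticeOf a) = r) :
    Nonempty (Basis (Fin r) ℤ (latticeOf a)) := by
  have : Module.Finite ℤ (latticeOf a) := Module.Finite.span_of_finite ℤ (Set.finite_range a)
  exact ⟨finBasisOfFinrankEq ℤ (latticeOf a) hr⟩

end Generators

section Augmented

variable {k m : ℕ}

/-- The vector `(x, ∑ l, x_l ahat_l)` of the augmented lattice, as a linear function of its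
coefficient part `x`. -/
noncomputable def augVec (ahat : Fin k → Fin m → ℤ) :
    (Fin k → ℤ) →ₗ[ℤ] EuclideanSpace ℝ (Fin k ⊕ Fin m) :=
  Fintype.linearCombination ℤ fun j => intVec (augmented ahat j)

theorem range_augVec (ahat : Fin k → Fin m → ℤ) :
    LinearMap.range (augVec ahat) = latticeOf fun j => intVec (augmented ahat j) :=
  Fintype.range_linearCombination ℤ _

theorem augVec_eq_intVec (ahat : Fin k → Fin m → ℤ) (x : Fin k → ℤ) :
    augVec ahat x = intVec (Sum.elim x (intComb x ahat)) := by
  ext t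
  rcases t with t | t
  · simp [augVec, Fintype.linearCombination_apply, intVec, augmented, Pi.single_apply]
  · simp [augVec, Fintype.linearCombination_apply, intVec, augmented, intComb]

theorem augVec_inl (ahat : Fin k → Fin m → ℤ) (x : Fin k → ℤ) (l : Fin k) :
    augVec ahat x (Sum.inl l) = x l := by
  rw [augVec_eq_intVec]
  rfl

/-- The real linear map `(x, y) ↦ ∑ l, x_l a_l`, which extends `x ↦ ∑ l, x_l a_l` to the space
spanned by the augmented lattice. -/
def combMap {E : Type*} [AddCommGroup E] [Module ℝ E] (a : Fin k → E) :
    EuclideanSpace ℝ (Fin k ⊕ Fin m) →ₗ[ℝ] E where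
  toFun z := ∑ l, z (Sum.inl l) • a l
  map_add' x y := by simp [add_smul, Finset.sum_add_distrib]
  map_smul' c x := by simp [mul_smul, Finset.smul_sum]

theorem combMap_intVec {E : Type*} [AddCommGroup E] [Module ℝ E] (a : Fin k → E)
    (z : Fin k ⊕ Fin m → ℤ) : combMap a (intVec z) = intComb (z ∘ Sum.inl) a := by
  simp [combMap, intVec, intComb, Int.cast_smul_eq_zsmul]

theorem combMap_augVec {E : Type*} [AddCommGroup E] [Module ℝ E] (a : Fin k → E)
    (ahat : Fin k → Fin m → ℤ) (x : Fin k → ℤ) : combMap a (augVec ahat x) = intComb x a := by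
  rw [augVec_eq_intVec, combMap_intVec, Sum.elim_comp_inl]

theorem norm_augVec_sq (ahat : Fin k → Fin m → ℤ) (x : Fin k → ℤ) :
    ‖augVec ahat x‖ ^ 2 = ‖intVec x‖ ^ 2 + ‖intVec (intComb x ahat)‖ ^ 2 := by
  simp [augVec_eq_intVec, EuclideanSpace.norm_sq_eq, intVec]

theorem norm_intVec_le_norm_augVec (ahat : Fin k → Fin m → ℤ) (x : Fin k → ℤ) :
    ‖intVec x‖ ≤ ‖augVec ahat x‖ := by
  refine le_of_sq_le_sq ?_ (norm_nonneg _)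
  rw [norm_augVec_sq]
  exact le_add_of_nonneg_right (sq_nonneg _)

theorem norm_intVec_intComb_le_norm_augVec (ahat : Fin k → Fin m → ℤ) (x : Fin k → ℤ) :
    ‖intVec (intComb x ahat)‖ ≤ ‖augVec ahat x‖ := by
  refine le_of_sq_le_sq ?_ (norm_nonneg _)
  rw [norm_augVec_sq]
  exact le_add_of_nonneg_left (sq_nonneg _)

theorem norm_augVec_le_add (ahat : Fin k → Fin m → ℤ) (x : Fin k → ℤ) :
    ‖augVec ahat x‖ ≤ ‖intVec x‖ + ‖intVec (intComb x ahat)‖ := by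
  refine le_of_sq_le_sq ?_ (by positivity)
  rw [norm_augVec_sq]
  nlinarith [mul_nonneg (norm_nonneg (intVec x)) (norm_nonneg (intVec (intComb x ahat)))]

end Augmented

section Approximation

theorem norm_le_sqrt_card_mul {ι : Type*} [Fintype ι] (z : EuclideanSpace ℝ ι) {C : ℝ}
    (hC : 0 ≤ C) (hz : ∀ i, |z i| ≤ C) : ‖z‖ ≤ √(Fintype.card ι : ℝ) * C := by
  refine le_of_sq_le_sq ?_ (by positivity)
  rw [EuclideanSpace.norm_sq_eq, mul_pow, Real.sq_sqrt (by positivity)]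
  calc ∑ i, ‖z i‖ ^ 2 ≤ ∑ _i : ι, C ^ 2 :=
        Finset.sum_le_sum fun i _ => pow_le_pow_left₀ (norm_nonneg _) (hz i) 2
    _ = Fintype.card ι * C ^ 2 := by simp

theorem sum_abs_le_sqrt_card_mul_norm {ι : Type*} [Fintype ι] (x : ι → ℤ) :
    ∑ l, |(x l : ℝ)| ≤ √(Fintype.card ι : ℝ) * ‖intVec x‖ := by
  refine le_of_sq_le_sq ?_ (by positivity)
  rw [mul_pow, Real.sq_sqrt (by positivity), EuclideanSpace.norm_sq_eq]
  simpa [intVec] using sq_sum_le_card_mul_sum_sq (s := Finset.univ) (f := fun l => |(x l : ℝ)|)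

/-- The factor `k √m 2 ^ (q₀ - q) + √k` by which the length of an augmented relation `(x, ∑ x_l
ahat_l)` can exceed the largest entry of `x`. -/
noncomputable def errorFactor (k m q₀ q : ℕ) : ℝ :=
  (k : ℝ) * √(m : ℝ) * (2 : ℝ) ^ ((q₀ : ℝ) - (q : ℝ)) + √(k : ℝ)

variable {k m q₀ q : ℕ} {a : Fin k → EuclideanSpace ℝ (Fin m)} {ahat : Fin k → Fin m → ℤ}

theorem errorFactor_nonneg : 0 ≤ errorFactor k m q₀ q := by
  unfold errorFactor
  positivity

theorem norm_intVec_intComb_sub_le (hahat : ∀ j, IsApprox q₀ q (ahat j) (a j)) (x : Fin k → ℤ) :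
    ‖intVec (intComb x ahat) - (2 : ℝ) ^ q₀ • intComb x a‖ ≤
      √(m : ℝ) * ((2 : ℝ) ^ q₀ / 2 ^ q * ∑ l, |(x l : ℝ)|) := by
  suffices hcoord : ∀ i, |(intVec (intComb x ahat) - (2 : ℝ) ^ q₀ • intComb x a) i| ≤
      (2 : ℝ) ^ q₀ / 2 ^ q * ∑ l, |(x l : ℝ)| by
    simpa using norm_le_sqrt_card_mul _ (by positivity) hcoord
  intro i
  have hsum : (intVec (intComb x ahat) - (2 : ℝ) ^ q₀ • intComb x a) i =
      ∑ l, (x l : ℝ) * (2 ^ q₀ * ((ahat l i : ℝ) / 2 ^ q₀ - a l i)) := by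
    simp only [mul_sub, mul_div_cancel₀ _ (pow_ne_zero q₀ (two_ne_zero' ℝ)),
      Finset.sum_sub_distrib]
    simp [intVec, intComb, Finset.mul_sum, mul_left_comm]
  rw [hsum, Finset.mul_sum]
  refine (Finset.abs_sum_le_sum_abs _ _).trans (Finset.sum_le_sum fun l _ => ?_)
  rw [abs_mul, abs_mul, abs_of_pos (by positivity : (0 : ℝ) < 2 ^ q₀)]
  calc |(x l : ℝ)| * (2 ^ q₀ * |(ahat l i : ℝ) / 2 ^ q₀ - a l i|)
      ≤ |(x l : ℝ)| * (2 ^ q₀ * (1 / 2 ^ q)) := by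
        gcongr
        exact hahat l i
    _ = 2 ^ q₀ / 2 ^ q * |(x l : ℝ)| := by ring

theorem norm_augVec_le (hahat : ∀ j, IsApprox q₀ q (ahat j) (a j)) {x : Fin k → ℤ} {C : ℝ}
    (hC : 0 ≤ C) (hx : ∀ l, |(x l : ℝ)| ≤ C) :
    ‖augVec ahat x‖ ≤ errorFactor k m q₀ q * C + 2 ^ q₀ * ‖intComb x a‖ := by
  have hx_norm : ‖intVec x‖ ≤ √(k : ℝ) * C := by
    simpa using norm_le_sqrt_card_mul (intVec x) hC hx
  have hx_sum : ∑ l, |(x l : ℝ)| ≤ k * C := by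
    simpa using Finset.sum_le_sum fun (l : Fin k) (_ : l ∈ Finset.univ) => hx l
  have htriangle : ‖intVec (intComb x ahat)‖ ≤
      √(m : ℝ) * ((2 : ℝ) ^ q₀ / 2 ^ q * ∑ l, |(x l : ℝ)|) + 2 ^ q₀ * ‖intComb x a‖ := by
    refine (norm_le_norm_sub_add _ ((2 : ℝ) ^ q₀ • intComb x a)).trans ?_
    rw [norm_smul, Real.norm_of_nonneg (by positivity)]
    gcongr
    exact norm_intVec_intComb_sub_le hahat x
  calc ‖augVec ahat x‖
      ≤ ‖intVec x‖ + ‖intVec (intComb x ahat)‖ := norm_augVec_le_add ahat x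
    _ ≤ √(k : ℝ) * C +
          (√(m : ℝ) * ((2 : ℝ) ^ q₀ / 2 ^ q * (k * C)) + 2 ^ q₀ * ‖intComb x a‖) := by
        refine add_le_add hx_norm (htriangle.trans ?_)
        gcongr
    _ = errorFactor k m q₀ q * C + 2 ^ q₀ * ‖intComb x a‖ := by
        rw [errorFactor, Real.rpow_sub two_pos, Real.rpow_natCast, Real.rpow_natCast]
        ring

theorem two_pow_mul_norm_intComb_le (hqq₀ : q ≤ q₀)
    (hahat : ∀ j, IsApprox q₀ q (ahat j) (a j)) (x : Fin k → ℤ) :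
    2 ^ q * ‖intComb x a‖ ≤ (√((m : ℝ) * (k : ℝ)) + 1) * ‖augVec ahat x‖ := by
  have hx_sum : ∑ l, |(x l : ℝ)| ≤ √(k : ℝ) * ‖augVec ahat x‖ := by
    refine (sum_abs_le_sqrt_card_mul_norm x).trans ?_
    rw [Fintype.card_fin]
    gcongr
    exact norm_intVec_le_norm_augVec ahat x
  have hpow : (1 : ℝ) ≤ 2 ^ q₀ / 2 ^ q :=
    (one_le_div (by positivity)).2 (pow_le_pow_right₀ one_le_two hqq₀)
  refine le_of_mul_le_mul_left ?_ (one_pos.trans_le hpow)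
  calc 2 ^ q₀ / 2 ^ q * (2 ^ q * ‖intComb x a‖)
      = ‖(2 : ℝ) ^ q₀ • intComb x a‖ := by
        rw [norm_smul, Real.norm_of_nonneg (by positivity)]
        field_simp
    _ ≤ ‖intVec (intComb x ahat)‖ + ‖intVec (intComb x ahat) - (2 : ℝ) ^ q₀ • intComb x a‖ := by
        rw [norm_sub_rev (intVec _)]
        exact norm_le_norm_add_norm_sub' _ _
    _ ≤ 2 ^ q₀ / 2 ^ q * ‖augVec ahat x‖ +
          √(m : ℝ) * ((2 : ℝ) ^ q₀ / 2 ^ q * (√(k : ℝ) * ‖augVec ahat x‖)) := by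
        refine add_le_add ?_ ((norm_intVec_intComb_sub_le hahat x).trans (by gcongr))
        exact (norm_intVec_intComb_le_norm_augVec ahat x).trans
          (le_mul_of_one_le_left (norm_nonneg _) hpow)
    _ = 2 ^ q₀ / 2 ^ q * ((√((m : ℝ) * (k : ℝ)) + 1) * ‖augVec ahat x‖) := by
        rw [Real.sqrt_mul (by positivity)]
        ring

theorem intComb_eq_zero_of_norm_augVec_lt (hqq₀ : q ≤ q₀)
    (hahat : ∀ j, IsApprox q₀ q (ahat j) (a j)) {μ : ℝ}
    (hμ : ∀ v ∈ latticeOf a, v ≠ 0 → μ ≤ ‖v‖) {x : Fin k → ℤ}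
    (hx : (√((m : ℝ) * (k : ℝ)) + 1) * ‖augVec ahat x‖ < 2 ^ q * μ) : intComb x a = 0 := by
  by_contra hne
  have hlt := (two_pow_mul_norm_intComb_le hqq₀ hahat x).trans_lt hx
  exact (lt_of_mul_lt_mul_left hlt (by positivity)).not_ge
    (hμ _ (intComb_mem_latticeOf x a) hne)

end Approximation

section Relations

variable {k m r q₀ q : ℕ}

/-- Cramer's rule in coordinates with respect to the basis `B` of the lattice, read as a relation
between the generator `a_l` and the generators `a_{s_1}, …, a_{s_r}`. -/
noncomputable def cramerRelation {E : Type*} [AddCommGroup E] {a : Fin k → E}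
    (B : Basis (Fin r) ℤ (latticeOf a)) (s : Fin r → Fin k) (l : Fin k) : Fin k → ℤ :=
  Pi.single l (B.det (generator a ∘ s)) -
    Function.extend s (fun i => B.det (Function.update (generator a ∘ s) i (generator a l))) 0

theorem intComb_cramerRelation {E : Type*} [AddCommGroup E] {a : Fin k → E}
    (B : Basis (Fin r) ℤ (latticeOf a)) {s : Fin r → Fin k} (hs : Function.Injective s)
    (l : Fin k) : intComb (cramerRelation B s l) a = 0 := by
  have hcramer := congrArg (latticeOf a).subtype
    (det_smul_eq_sum_det_update_smul B (generator a ∘ s) (generator a l))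
  rw [map_sum] at hcramer
  rw [cramerRelation, intComb_sub, intComb_single, intComb_extend hs, sub_eq_zero]
  exact hcramer

section Entries

variable {E : Type*} [AddCommGroup E] {a : Fin k → E} {s : Fin r → Fin k}
  (B : Basis (Fin r) ℤ (latticeOf a))

theorem cramerRelation_apply_of_notMem_range {l t : Fin k} (ht : t ∉ Set.range s) :
    cramerRelation B s l t = if t = l then B.det (generator a ∘ s) else 0 := by
  rw [cramerRelation, Pi.sub_apply, Function.extend_apply' _ _ _ ht, Pi.zero_apply, sub_zero,
    Pi.single_apply]

theorem cramerRelation_apply_range (hs : Function.Injective s) {l : Fin k}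
    (hl : l ∉ Set.range s) (i : Fin r) : cramerRelation B s l (s i) =
      -B.det (Function.update (generator a ∘ s) i (generator a l)) := by
  rw [cramerRelation, Pi.sub_apply, hs.extend_apply,
    Pi.single_eq_of_ne (ne_of_mem_of_not_mem (Set.mem_range_self i) hl), zero_sub]

end Entries

section Bounds

variable {E : Type*} [NormedAddCommGroup E] [InnerProductSpace ℝ E]

theorem abs_det_mul_latticeDet_le_pow {L : Submodule ℤ E} (B : Basis (Fin r) ℤ L)
    {w : Fin r → L} {α : ℝ} (hw : ∀ i, ‖w i‖ ≤ α) :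
    |(B.det w : ℝ)| * latticeDet L ≤ α ^ r :=
  (abs_det_mul_latticeDet_le B w).trans <|
    (Finset.prod_le_prod (fun i _ => norm_nonneg (w i)) fun i _ => hw i).trans_eq (by simp)

variable {a : Fin k → E} {s : Fin r → Fin k} {α : ℝ}

theorem abs_cramerRelation_mul_latticeDet_le (B : Basis (Fin r) ℤ (latticeOf a))
    (hs : Function.Injective s) (hα : ∀ j, ‖a j‖ ≤ α) {l : Fin k} (hl : l ∉ Set.range s)
    (t : Fin k) : |(cramerRelation B s l t : ℝ)| * latticeDet (latticeOf a) ≤ α ^ r := by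
  have hgen : ∀ j, ‖generator a j‖ ≤ α := hα
  rcases em (t ∈ Set.range s) with ⟨i, rfl⟩ | ht
  · rw [cramerRelation_apply_range B hs hl, Int.cast_neg, abs_neg]
    refine abs_det_mul_latticeDet_le_pow B fun j => ?_
    rcases eq_or_ne j i with rfl | hji
    · simpa only [Function.update_self] using hgen l
    · simpa only [Function.update_of_ne hji, Function.comp_apply] using hgen (s j)
  · rw [cramerRelation_apply_of_notMem_range B ht]
    split_ifs
    · exact abs_det_mul_latticeDet_le_pow B fun j => hgen (s j)
    · simpa using pow_nonneg ((norm_nonneg _).trans (hα l)) r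

theorem prod_norm_update_mul_le {F ι : Type*} [SeminormedAddGroup F] [Fintype ι] [DecidableEq ι]
    {w : ι → F} {α : ℝ} (hw : ∀ i, ‖w i‖ ≤ α) (i : ι) (x : F) :
    (∏ t, ‖Function.update w i x t‖) * α ≤ ‖x‖ * α ^ Fintype.card ι := by
  have hα : 0 ≤ α := (norm_nonneg _).trans (hw i)
  have hprod : ∏ t ∈ Finset.univ.erase i, ‖Function.update w i x t‖ ≤
      α ^ (Fintype.card ι - 1) := by
    rw [← Finset.card_univ, ← Finset.card_erase_of_mem (Finset.mem_univ i), ← Finset.prod_const]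
    refine Finset.prod_le_prod (fun t _ => norm_nonneg _) fun t ht => ?_
    rw [Function.update_of_ne (Finset.ne_of_mem_erase ht)]
    exact hw t
  rw [← Finset.mul_prod_erase _ _ (Finset.mem_univ i), Function.update_self, mul_assoc,
    ← Nat.sub_add_cancel (Fintype.card_pos_iff.2 ⟨i⟩), pow_succ]
  gcongr

/-- By Cramer's rule `c i` is a quotient whose denominator `B.det w` is a nonzero integer, so the
numerator bounds it. -/
theorem abs_coeff_mul_latticeDet_mul_le {L : Submodule ℤ E} (B : Basis (Fin r) ℤ L)
    {w : Fin r → L} (hw : LinearIndependent ℝ fun i => (w i : E)) (hα : ∀ i, ‖w i‖ ≤ α)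
    (c : Fin r → ℤ) (i : Fin r) :
    |(c i : ℝ)| * latticeDet L * α ≤ ‖∑ j, c j • w j‖ * α ^ r := by
  have hα_nonneg : 0 ≤ α := (norm_nonneg _).trans (hα i)
  have hdet : (1 : ℝ) ≤ |(B.det w : ℝ)| :=
    mod_cast Int.one_le_abs (det_ne_zero_of_linearIndependent B hw)
  have hnumerator : |(c i : ℝ)| ≤
      |(B.det (Function.update w i (∑ j, c j • w j)) : ℝ)| := by
    rw [det_update_sum_smul, smul_eq_mul, Int.cast_mul, abs_mul]
    exact le_mul_of_one_le_right (abs_nonneg _) hdet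
  calc |(c i : ℝ)| * latticeDet L * α
      ≤ |(B.det (Function.update w i (∑ j, c j • w j)) : ℝ)| * latticeDet L * α := by
        gcongr
        exact (latticeDet_pos B hw).le
    _ ≤ (∏ t, ‖Function.update w i (∑ j, c j • w j) t‖) * α := by
        gcongr
        exact abs_det_mul_latticeDet_le B _
    _ ≤ ‖∑ j, c j • w j‖ * α ^ r := by
        simpa only [Fintype.card_fin] using prod_norm_update_mul_le hα i (∑ j, c j • w j)

end Bounds

/-- The paper's `λ`, which bounds the length of the augmented Cramer relations. -/
noncomputable def relationBound (q₀ q r : ℕ) (a : Fin k → EuclideanSpace ℝ (Fin m)) (α : ℝ) : ℝ :=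
  errorFactor k m q₀ q * (α ^ r / latticeDet (latticeOf a))

variable {a : Fin k → EuclideanSpace ℝ (Fin m)} {ahat : Fin k → Fin m → ℤ} {s : Fin r → Fin k}
  {α : ℝ}

theorem norm_augVec_cramerRelation_le (B : Basis (Fin r) ℤ (latticeOf a))
    (hahat : ∀ j, IsApprox q₀ q (ahat j) (a j))
    (hs : LinearIndependent ℝ fun i => a (s i)) (hα : ∀ j, ‖a j‖ ≤ α) {l : Fin k}
    (hl : l ∉ Set.range s) :
    ‖augVec ahat (cramerRelation B s l)‖ ≤ relationBound q₀ q r a α := by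
  have hinj : Function.Injective s := hs.injective.of_comp (f := a)
  have hdet : 0 < latticeDet (latticeOf a) := latticeDet_pos B (w := generator a ∘ s) hs
  have hα_nonneg : 0 ≤ α := (norm_nonneg _).trans (hα l)
  have hentry : ∀ t, |(cramerRelation B s l t : ℝ)| ≤ α ^ r / latticeDet (latticeOf a) :=
    fun t => (le_div_iff₀ hdet).2 (abs_cramerRelation_mul_latticeDet_le B hinj hα hl t)
  simpa [relationBound, intComb_cramerRelation B hinj] using
    norm_augVec_le hahat (by positivity) hentry

theorem linearIndependent_augVec_cramerRelation (B : Basis (Fin r) ℤ (latticeOf a))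
    (ahat : Fin k → Fin m → ℤ)
    (hs : LinearIndependent ℝ fun i => a (s i)) :
    LinearIndependent ℝ fun l : ↥(Set.range s)ᶜ => augVec ahat (cramerRelation B s l) := by
  have hdet := det_ne_zero_of_linearIndependent B (w := generator a ∘ s) hs
  rw [Fintype.linearIndependent_iff]
  intro g hg t
  have hcoord := congrArg (fun z => z (Sum.inl t.1)) hg
  simp only [WithLp.ofLp_sum, Finset.sum_apply, WithLp.ofLp_smul, Pi.smul_apply, augVec_inl,
    cramerRelation_apply_of_notMem_range B t.2, Subtype.coe_inj, smul_eq_mul] at hcoord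
  simpa [hdet] using hcoord

theorem card_compl_range (hs : Function.Injective s) :
    Fintype.card ↥(Set.range s)ᶜ = k - r := by
  rw [Fintype.card_compl_set, Set.card_range_of_injective hs, Fintype.card_fin, Fintype.card_fin]

theorem exists_intComb_eq_norm_augVec_le (B : Basis (Fin r) ℤ (latticeOf a))
    (hahat : ∀ j, IsApprox q₀ q (ahat j) (a j))
    (hs : LinearIndependent ℝ fun i => a (s i)) (hα : ∀ j, ‖a j‖ ≤ α) (hα_pos : 0 < α)
    (hbound : relationBound q₀ q r a α ≤ 2 ^ q₀ * α) {v : EuclideanSpace ℝ (Fin m)}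
    (hv : v ∈ latticeOf (a ∘ s)) :
    ∃ c : Fin k → ℤ, intComb c a = v ∧ ‖augVec ahat c‖ ≤ 2 ^ (q₀ + 1) * ‖v‖ := by
  have hinj : Function.Injective s := hs.injective.of_comp (f := a)
  have hdet : 0 < latticeDet (latticeOf a) := latticeDet_pos B (w := generator a ∘ s) hs
  obtain ⟨c, rfl⟩ := (Submodule.mem_span_range_iff_exists_fun ℤ).1 hv
  set v := ∑ i, c i • (a ∘ s) i with hv_def
  set C := ‖v‖ / α * (α ^ r / latticeDet (latticeOf a)) with hC
  have hcoeff : ∀ i, |(c i : ℝ)| ≤ C := by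
    intro i
    rw [hC, div_mul_div_comm, le_div_iff₀ (by positivity), mul_comm α, ← mul_assoc]
    simpa [generator, hv_def] using abs_coeff_mul_latticeDet_mul_le B (w := generator a ∘ s) hs
      (fun j => hα (s j)) c i
  have hentry : ∀ t, |((Function.extend s c 0 t : ℤ) : ℝ)| ≤ C := by
    intro t
    rcases em (t ∈ Set.range s) with ⟨i, rfl⟩ | ht
    · exact (hinj.extend_apply c 0 i).symm ▸ hcoeff i
    · rw [Function.extend_apply' _ _ _ ht]
      simp only [Pi.zero_apply, Int.cast_zero, abs_zero]
      positivity
  have hlift : intComb (Function.extend s c 0) a = v := intComb_extend hinj c a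
  refine ⟨Function.extend s c 0, hlift, ?_⟩
  calc ‖augVec ahat (Function.extend s c 0)‖
      ≤ errorFactor k m q₀ q * C + 2 ^ q₀ * ‖v‖ := by
        simpa only [hlift] using norm_augVec_le hahat (by positivity) hentry
    _ = ‖v‖ / α * relationBound q₀ q r a α + 2 ^ q₀ * ‖v‖ := by
        rw [hC, relationBound]
        ring
    _ ≤ ‖v‖ / α * (2 ^ q₀ * α) + 2 ^ q₀ * ‖v‖ := by gcongr
    _ = 2 ^ (q₀ + 1) * ‖v‖ := by
        field_simp
        ring

end Relations

section LLLBasis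

theorem linearIndependent_sumElim_of_map {K V W ι κ : Type*} [Ring K] [AddCommGroup V]
    [Module K V] [AddCommGroup W] [Module K W] (f : V →ₗ[K] W) {u : ι → V} {w : κ → V}
    (hu : LinearIndependent K u) (hfu : ∀ i, f (u i) = 0) (hw : LinearIndependent K (f ∘ w)) :
    LinearIndependent K (Sum.elim u w) := by
  refine hu.sum_type hw.of_comp ((Submodule.range_ker_disjoint hw).symm.mono_left ?_)
  exact Submodule.span_le.2 (Set.range_subset_iff.2 hfu)

variable {k m r q₀ q : ℕ} {a : Fin k → EuclideanSpace ℝ (Fin m)} {ahat : Fin k → Fin m → ℤ}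
  {b : Fin k → Fin k ⊕ Fin m → ℤ} {s : Fin r → Fin k} {α μ : ℝ}

theorem IsLLLReducedBasis.intVec_eq_augVec
    (h : IsLLLReducedBasis (latticeOf fun j => intVec (augmented ahat j)) fun j => intVec (b j))
    (j : Fin k) : intVec (b j) = augVec ahat (coeffPart b j) := by
  have hmem : intVec (b j) ∈ LinearMap.range (augVec ahat) := by
    rw [range_augVec, ← h.2]
    exact Submodule.subset_span (Set.mem_range_self j)
  obtain ⟨x, hx⟩ := hmem
  have hcoeff : x = coeffPart b j := by
    funext l
    have hl : (x l : ℝ) = b j (Sum.inl l) := by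
      rw [← augVec_inl ahat, hx]
      rfl
    exact mod_cast hl
  rw [← hcoeff, hx]

theorem IsLLLReducedBasis.linearIndependent_coeffPart
    (h : IsLLLReducedBasis (latticeOf fun j => intVec (augmented ahat j)) fun j => intVec (b j)) :
    LinearIndependent ℤ (coeffPart b) := by
  refine LinearIndependent.of_comp (augVec ahat) ?_
  simpa only [h.intVec_eq_augVec, Function.comp_def] using
    h.1.linearIndependent.restrict_scalars' ℤ

theorem IsLLLReducedBasis.norm_augVec_coeffPart_le
    (h : IsLLLReducedBasis (latticeOf fun j => intVec (augmented ahat j)) fun j => intVec (b j))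
    {ι : Type*} [Fintype ι] {x : ι → Fin k → ℤ}
    (hx : LinearIndependent ℝ fun t => augVec ahat (x t)) {M : ℝ}
    (hM : ∀ t, ‖augVec ahat (x t)‖ ≤ M) {j : Fin k} (hj : (j : ℕ) < Fintype.card ι) :
    ‖augVec ahat (coeffPart b j)‖ ≤ (2 : ℝ) ^ (((k : ℝ) - 1) / 2) * M := by
  rw [← h.intVec_eq_augVec]
  refine h.1.norm_le_of_linearIndependent hx (fun t => ?_) hM hj
  rw [h.2, ← range_augVec]
  exact LinearMap.mem_range_self _ _

theorem IsLLLReducedBasis.norm_augVec_coeffPart_firstIdx_le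
    (h : IsLLLReducedBasis (latticeOf fun j => intVec (augmented ahat j)) fun j => intVec (b j))
    (B : Basis (Fin r) ℤ (latticeOf a)) (hahat : ∀ j, IsApprox q₀ q (ahat j) (a j))
    (hs : LinearIndependent ℝ fun i => a (s i)) (hα : ∀ j, ‖a j‖ ≤ α) (j : Fin (k - r)) :
    ‖augVec ahat (coeffPart b (firstIdx j))‖ ≤
      (2 : ℝ) ^ (((k : ℝ) - 1) / 2) * relationBound q₀ q r a α :=
  h.norm_augVec_coeffPart_le (linearIndependent_augVec_cramerRelation B ahat hs)
    (fun l => norm_augVec_cramerRelation_le B hahat hs hα l.2)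
    (j.isLt.trans_eq (card_compl_range (hs.injective.of_comp (f := a))).symm)

theorem IsLLLReducedBasis.norm_augVec_coeffPart_le_of_linearIndependent
    (h : IsLLLReducedBasis (latticeOf fun j => intVec (augmented ahat j)) fun j => intVec (b j))
    (B : Basis (Fin r) ℤ (latticeOf a)) (hahat : ∀ j, IsApprox q₀ q (ahat j) (a j))
    (hs : LinearIndependent ℝ fun i => a (s i)) (hα : ∀ j, ‖a j‖ ≤ α) (hα_pos : 0 < α)
    (hbound : relationBound q₀ q r a α ≤ 2 ^ q₀ * α) {ι : Type*} [Fintype ι]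
    {v : ι → EuclideanSpace ℝ (Fin m)} (hv : LinearIndependent ℝ v)
    (hv_mem : ∀ i, v i ∈ latticeOf (a ∘ s)) {ρ : ℝ} (hρ : ∀ i, ‖v i‖ ≤ ρ)
    (hbound_ρ : relationBound q₀ q r a α ≤ 2 ^ (q₀ + 1) * ρ) {j : Fin k}
    (hj : (j : ℕ) < k - r + Fintype.card ι) :
    ‖augVec ahat (coeffPart b j)‖ ≤ (2 : ℝ) ^ (((k : ℝ) - 1) / 2) * (2 ^ (q₀ + 1) * ρ) := by
  have hinj : Function.Injective s := hs.injective.of_comp (f := a)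
  choose c hc hc_norm using fun i =>
    exists_intComb_eq_norm_augVec_le B hahat hs hα hα_pos hbound (hv_mem i)
  let x : ↥(Set.range s)ᶜ ⊕ ι → Fin k → ℤ := Sum.elim (fun l => cramerRelation B s l) c
  have hx : augVec ahat ∘ x =
      Sum.elim (fun l : ↥(Set.range s)ᶜ => augVec ahat (cramerRelation B s l))
        fun i => augVec ahat (c i) :=
    Sum.comp_elim _ _ _
  have hx_indep : LinearIndependent ℝ (augVec ahat ∘ x) := by
    rw [hx]
    refine linearIndependent_sumElim_of_map (combMap a)
      (linearIndependent_augVec_cramerRelation B ahat hs) (fun l => ?_) ?_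
    · rw [combMap_augVec, intComb_cramerRelation B hinj]
    · simpa only [Function.comp_def, combMap_augVec, hc] using hv
  refine h.norm_augVec_coeffPart_le hx_indep ?_ ?_
  · rintro (l | i)
    · exact (norm_augVec_cramerRelation_le B hahat hs hα l.2).trans hbound_ρ
    · exact (hc_norm i).trans (by gcongr; exact hρ i)
  · rwa [Fintype.card_sum, card_compl_range hinj]

theorem le_mul_successiveMin {E : Type*} [NormedAddCommGroup E] [InnerProductSpace ℝ E]
    {L : Submodule ℤ E} {n : ℕ} {w : Fin n → E} (hw : LinearIndependent ℝ w)
    (hwL : ∀ i, w i ∈ L) {C X : ℝ} (hC : 0 < C)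
    (h : ∀ (ρ : ℝ) (v : Fin n → E), LinearIndependent ℝ v → (∀ i, v i ∈ L ∧ ‖v i‖ ≤ ρ) →
      X ≤ C * ρ) : X ≤ C * successiveMin L n := by
  rw [← div_le_iff₀' hC]
  refine le_csInf ⟨∑ i, ‖w i‖, Finset.sum_nonneg fun _ _ => norm_nonneg _, w, hw, fun i =>
    ⟨hwL i, Finset.single_le_sum (f := fun i => ‖w i‖) (fun _ _ => norm_nonneg _)
      (Finset.mem_univ i)⟩⟩ ?_
  rintro ρ ⟨-, v, hv, hvL⟩
  exact (div_le_iff₀' hC).2 (h ρ v hv hvL)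

theorem relationBound_nonneg (B : Basis (Fin r) ℤ (latticeOf a))
    (hs : LinearIndependent ℝ fun i => a (s i)) (hα : 0 ≤ α) : 0 ≤ relationBound q₀ q r a α :=
  have hdet : 0 < latticeDet (latticeOf a) := latticeDet_pos B (w := generator a ∘ s) hs
  mul_nonneg errorFactor_nonneg (by positivity)

theorem le_two_pow_mul_of_precision (hk : 0 < k) (hqq₀ : q ≤ q₀) (hμ : 0 ≤ μ) {lam : ℝ}
    (hlam : 0 ≤ lam) (hprec : (√((m : ℝ) * (k : ℝ)) + 1) *
      ((2 : ℝ) ^ (((k : ℝ) - 1) / 2) * lam) < 2 ^ q * μ) : lam ≤ 2 ^ q₀ * μ := by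
  have hk_one : (1 : ℝ) ≤ k := mod_cast hk
  have hK : 1 ≤ (2 : ℝ) ^ (((k : ℝ) - 1) / 2) := Real.one_le_rpow one_le_two (by linarith)
  calc lam ≤ (2 : ℝ) ^ (((k : ℝ) - 1) / 2) * lam := le_mul_of_one_le_left hlam hK
    _ ≤ (√((m : ℝ) * (k : ℝ)) + 1) * ((2 : ℝ) ^ (((k : ℝ) - 1) / 2) * lam) :=
        le_mul_of_one_le_left (by positivity) (le_add_of_nonneg_left (Real.sqrt_nonneg _))
    _ ≤ 2 ^ q * μ := hprec.le
    _ ≤ 2 ^ q₀ * μ := by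
        gcongr
        exact one_le_two

theorem IsLLLReducedBasis.norm_augVec_coeffPart_lastIdx_le (hrk : r ≤ k)
    (h : IsLLLReducedBasis (latticeOf fun j => intVec (augmented ahat j)) fun j => intVec (b j))
    (B : Basis (Fin r) ℤ (latticeOf a)) (hqq₀ : q ≤ q₀)
    (hahat : ∀ j, IsApprox q₀ q (ahat j) (a j)) (hs : LinearIndependent ℝ fun i => a (s i))
    (hα : ∀ j, ‖a j‖ ≤ α) (hμ_pos : 0 < μ) (hμ : ∀ v ∈ latticeOf a, v ≠ 0 → μ ≤ ‖v‖)
    (hprec : (√((m : ℝ) * (k : ℝ)) + 1) *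
      ((2 : ℝ) ^ (((k : ℝ) - 1) / 2) * relationBound q₀ q r a α) < 2 ^ q * μ) (j : Fin r) :
    ‖augVec ahat (coeffPart b (lastIdx hrk j))‖ ≤ (2 : ℝ) ^ (((k : ℝ) - 1) / 2) *
      2 ^ (q₀ + 1) * successiveMin (latticeOf fun i => a (s i)) (j + 1) := by
  have hμα : μ ≤ α := (hμ _ (generator a (s j)).2 (hs.ne_zero j)).trans (hα (s j))
  have hα_pos : 0 < α := hμ_pos.trans_le hμα
  have hbound : relationBound q₀ q r a α ≤ 2 ^ q₀ * μ :=
    le_two_pow_mul_of_precision (j.pos.trans_le hrk) hqq₀ hμ_pos.le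
      (relationBound_nonneg B hs hα_pos.le) hprec
  refine le_mul_successiveMin (w := fun i => a (s (Fin.castLE j.isLt i)))
    (hs.comp _ (Fin.castLE_injective _)) (fun i => (generator (a ∘ s) _).2) (by positivity)
    fun ρ v hv hvL => ?_
  have hμρ : μ ≤ ρ :=
    (hμ _ (latticeOf_comp_le a s (hvL 0).1) (hv.ne_zero 0)).trans (hvL 0).2
  rw [mul_assoc]
  refine h.norm_augVec_coeffPart_le_of_linearIndependent B hahat hs hα hα_pos
    (hbound.trans (by gcongr)) hv (fun i => (hvL i).1) (fun i => (hvL i).2) ?_ ?_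
  · calc relationBound q₀ q r a α ≤ 2 ^ q₀ * μ := hbound
      _ ≤ 2 ^ (q₀ + 1) * ρ := by
          gcongr
          · exact one_le_two
          · exact q₀.le_succ
  · rw [Fintype.card_fin]
    exact Nat.add_lt_add_left j.val.lt_succ_self _

theorem IsLLLReducedBasis.latticeOf_intComb_coeffPart
    (h : IsLLLReducedBasis (latticeOf fun j => intVec (augmented ahat j)) fun j => intVec (b j))
    {E : Type*} [AddCommGroup E] [Module ℝ E] (a : Fin k → E) :
    latticeOf (fun j => intComb (coeffPart b j) a) = latticeOf a := by
  have haugmented (j : Fin k) : intComb (augmented ahat j ∘ Sum.inl) a = a j :=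
    (intComb_single j 1 a).trans (one_smul ℤ _)
  have hmap := congrArg (Submodule.map ((combMap a).restrictScalars ℤ)) h.2
  simp only [map_latticeOf, Function.comp_def, LinearMap.restrictScalars_apply, combMap_intVec]
    at hmap haugmented
  simp only [haugmented] at hmap
  exact hmap

theorem firstIdx_injective : Function.Injective (firstIdx : Fin (k - r) → Fin k) :=
  fun _ _ h => Fin.ext (Fin.mk.inj h)

theorem latticeOf_comp_lastIdx {E : Type*} [AddCommGroup E] (hrk : r ≤ k) {v : Fin k → E}
    (hv : ∀ j : Fin (k - r), v (firstIdx j) = 0) :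
    latticeOf (v ∘ lastIdx hrk) = latticeOf v := by
  refine (latticeOf_comp_le v _).antisymm (Submodule.span_le.2 (Set.range_subset_iff.2 fun j => ?_))
  rcases lt_or_ge (j : ℕ) (k - r) with hj | hj
  · exact (hv ⟨j, hj⟩ : v j = 0) ▸ Submodule.zero_mem _
  · have hlast : lastIdx hrk ⟨j - (k - r), by omega⟩ = j :=
      Fin.ext (Nat.add_sub_of_le hj)
    exact Submodule.subset_span ⟨_, congrArg v hlast⟩

theorem linearIndependent_of_latticeOf_eq {E ι κ : Type*} [AddCommGroup E] [Module ℝ E]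
    [Finite κ] {v : κ → E} {a : ι → E} (h : latticeOf v = latticeOf a) {s : κ → ι}
    (hs : LinearIndependent ℝ fun i => a (s i)) : LinearIndependent ℝ v := by
  have := Fintype.ofFinite κ
  have hle : Submodule.span ℝ (Set.range fun i => a (s i)) ≤
      Submodule.span ℝ (Set.range v) := by
    refine Submodule.span_le.2 (Set.range_subset_iff.2 fun i => ?_)
    exact Submodule.span_le_restrictScalars ℤ ℝ _
      (show a (s i) ∈ latticeOf v from h ▸ (generator a (s i)).2)
  have : FiniteDimensional ℝ (Submodule.span ℝ (Set.range v)) :=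
    FiniteDimensional.span_of_finite ℝ (Set.finite_range v)
  rw [linearIndependent_iff_card_le_finrank_span, Set.finrank, ← finrank_span_eq_card hs]
  exact Submodule.finrank_mono hle

theorem two_rpow_add_natCast_add_one (x : ℝ) (n : ℕ) :
    (2 : ℝ) ^ (x + n + 1) = 2 ^ x * 2 ^ (n + 1) := by
  rw [add_assoc, Real.rpow_add two_pos]
  exact_mod_cast rfl

theorem two_rpow_add_one_add_sub_natCast (x : ℝ) (n l : ℕ) :
    (2 : ℝ) ^ (x + 1 + n - l) = 2 ^ x * 2 ^ (n + 1) / 2 ^ l := by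
  rw [Real.rpow_sub two_pos, Real.rpow_natCast, add_right_comm, two_rpow_add_natCast_add_one]

end LLLBasis

end ApproxLattice

/-- `a_1, …, a_k` generate a lattice `L` of rank `r` in `ℝ^m`, `ahat_j` are approximations of
precision `q` and denominator `2 ^ q₀`, and `btilde_j = (m_j, bhat_j)` is any LLL-reduced basis
of the lattice generated by the vectors `(e_j, ahat_j)`. The family `a ∘ s` is any choice of `r` linearly
independent vectors among the `a_j` and generates `L_r`; the hypothesis `hμ` says `μ ≤ λ_1(L)`. -/
theorem mainTheorem2 {k m r : ℕ} (hrk : r ≤ k) (q₀ q : ℕ) (hq : 0 < q) (hqq₀ : q ≤ q₀)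
    (a : Fin k → EuclideanSpace ℝ (Fin m))
    (hdiscrete : DiscreteTopology (latticeOf a))
    (hrank : Module.finrank ℤ (latticeOf a) = r)
    (ahat : Fin k → Fin m → ℤ) (hahat : ∀ j, IsApprox q₀ q (ahat j) (a j))
    (btilde : Fin k → Fin k ⊕ Fin m → ℤ)
    (hbtilde : IsLLLReducedBasis (latticeOf fun j => intVec (augmented ahat j))
      (fun j => intVec (btilde j)))
    (s : Fin r → Fin k) (hs : LinearIndependent ℝ (fun i => a (s i)))
    (μ : ℝ) (hμ_pos : 0 < μ) (hμ : ∀ v ∈ latticeOf a, v ≠ 0 → μ ≤ ‖v‖)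
    (α : ℝ) (hα : ∀ j, ‖a j‖ ≤ α)
    (lam : ℝ)
    (hlam : lam = ((k : ℝ) * √(m : ℝ) * (2 : ℝ) ^ ((q₀ : ℝ) - (q : ℝ)) + √(k : ℝ)) *
      (α ^ r / latticeDet (latticeOf a)))
    (hprec : (2 : ℝ) ^ q >
      (√((m : ℝ) * (k : ℝ)) + 1) * lam * (2 : ℝ) ^ (((k : ℝ) - 1) / 2) / μ) :
    -- the first `k - r` coefficient vectors are linearly independent relations
    LinearIndependent ℤ (fun j : Fin (k - r) => coeffPart btilde (firstIdx j)) ∧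
    (∀ j : Fin (k - r), intComb (coeffPart btilde (firstIdx j)) a = 0) ∧
    -- the last `r` ones give a basis of `L`
    LinearIndependent ℝ (fun j : Fin r => intComb (coeffPart btilde (lastIdx hrk j)) a) ∧
    latticeOf (fun j : Fin r => intComb (coeffPart btilde (lastIdx hrk j)) a) = latticeOf a ∧
    (∀ j : Fin r, ‖intComb (coeffPart btilde (lastIdx hrk j)) a‖ ≤
      (√((k : ℝ) * (m : ℝ)) + 1) *
        (2 : ℝ) ^ (((k : ℝ) - 1) / 2 + 1 + (q₀ : ℝ) - (q : ℝ)) *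
        successiveMin (latticeOf fun i => a (s i)) ((j : ℕ) + 1)) ∧
    -- norm bounds for the coefficient vectors
    (∀ j : Fin (k - r), ‖intVec (coeffPart btilde (firstIdx j))‖ ≤
      (2 : ℝ) ^ (((k : ℝ) - 1) / 2) * lam) ∧
    (∀ j : Fin r, ‖intVec (coeffPart btilde (lastIdx hrk j))‖ ≤
      (2 : ℝ) ^ (((k : ℝ) - 1) / 2 + (q₀ : ℝ) + 1) *
        successiveMin (latticeOf fun i => a (s i)) ((j : ℕ) + 1)) := by
  obtain rfl : lam = relationBound q₀ q r a α := hlam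
  have : IsAddTorsionFree (EuclideanSpace ℝ (Fin m)) := .of_isTorsionFree ℝ _
  obtain ⟨B⟩ := exists_basis_latticeOf a hrank
  rw [gt_iff_lt, div_lt_iff₀ hμ_pos, mul_assoc, mul_comm (relationBound q₀ q r a α)] at hprec
  have hfirst := hbtilde.norm_augVec_coeffPart_firstIdx_le B hahat hs hα
  have hlast := hbtilde.norm_augVec_coeffPart_lastIdx_le hrk B hqq₀ hahat hs hα hμ_pos hμ hprec
  have hrel (j : Fin (k - r)) : intComb (coeffPart btilde (firstIdx j)) a = 0 :=
    intComb_eq_zero_of_norm_augVec_lt hqq₀ hahat hμ <| hprec.trans_le' <| by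
      gcongr
      exact hfirst j
  have hgen := (latticeOf_comp_lastIdx hrk hrel).trans (hbtilde.latticeOf_intComb_coeffPart a)
  refine ⟨hbtilde.linearIndependent_coeffPart.comp _ firstIdx_injective, hrel,
    linearIndependent_of_latticeOf_eq hgen hs, hgen, fun j => ?_,
    fun j => (norm_intVec_le_norm_augVec ahat _).trans (hfirst j), fun j => ?_⟩
  · rw [two_rpow_add_one_add_sub_natCast, mul_div_assoc', div_mul_eq_mul_div,
      le_div_iff₀' (by positivity), mul_assoc, mul_comm (k : ℝ)]
    refine (two_pow_mul_norm_intComb_le hqq₀ hahat _).trans ?_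
    gcongr
    exact hlast j
  · rw [two_rpow_add_natCast_add_one]
    exact (norm_intVec_le_norm_augVec ahat _).trans (hlast j)
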